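/- Let $p,q\ge 0$ with $p+q=1$ and let $\beta>0$. Consider the asymmetric simple exclusion process on $\{0,1,2,\dots\}$ with an open boundary at $0$ and no injection ($\alpha=0$): independently of one another, each particle jumps one step to the right at rate $p$ and, if it is not at $0$, one step to the left at rate $q$, provided the target site is empty; a particle at site $0$ is moreover ejected from the system at rate $\beta$. Start the process at time $0$ with a single particle, located at a site $y\ge 0$. (i) If $p>q$, then the particle is never ejected with probability $$1-\frac{\beta\,(q^{-1}-1)^{-y}}{p-q+\beta}.$$ (For $q=0$ the factor $(q^{-1}-1)^{-y}=(q/p)^y$ is read as $1$ if $y=0$ and as $0$ if $y>0$.) (ii) If $p\le q$, then with probability one the particle is eventually ejected. (iii) If $p=q$, then the expected time at which the particle is ejected is infinite. (iv) If $p<q$, then the expected time at which the particle is ejected is $$\frac{y+q/\beta}{q-p}.$$ -/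

import Mathlib

open MeasureTheory ProbabilityTheory
open scoped ENNReal NNReal

noncomputable section

namespace OpenASEP

/-! ### Continuous-time Markov chains on a countable state space

A chain is specified by its jump rates: `R x` is the (finite) measure on the state space for which
`R x {z}` is the rate of the jump `x → z`.  The chain is realised by its jump chain and its
holding times: given the jump chain `Y`, the successive holding times are independent, and the
`n`-th one is exponential with parameter the total rate `R (Y n) univ`
(it is infinite when the state `Y n` is absorbing). -/

section MarkovChain

variable {S : Type} [MeasurableSpace S] [DiscreteMeasurableSpace S] [Countable S]

/-- Law of the state after a jump from `x`: the rates out of `x`, normalised.  An absorbing state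
(total rate `0`) stays where it is. -/
def jumpLaw (R : S → Measure S) (x : S) : Measure S :=
  open Classical in
  if R x Set.univ = 0 then Measure.dirac x else (R x Set.univ)⁻¹ • R x

instance (R : S → Measure S) [∀ x, IsFiniteMeasure (R x)] (x : S) :
    IsProbabilityMeasure (jumpLaw R x) := by
  unfold jumpLaw
  split_ifs with h
  · infer_instance
  · exact ⟨by simp [ENNReal.inv_mul_cancel h (measure_ne_top (R x) _)]⟩

/-- The transition kernel of the jump chain. -/
def jumpKernel (R : S → Measure S) : Kernel S S where
  toFun := jumpLaw R
  measurable' := measurable_of_countable _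

instance (R : S → Measure S) [∀ x, IsFiniteMeasure (R x)] : IsMarkovKernel (jumpKernel R) :=
  ⟨fun x => inferInstanceAs (IsProbabilityMeasure (jumpLaw R x))⟩

/-- The `n`-th step of the jump chain, as a kernel from the past `(Y 0, …, Y n)` to `Y (n + 1)`;
it depends on the past through `Y n` only. -/
def stepKernel (R : S → Measure S) (n : ℕ) : Kernel ((i : Finset.Iic n) → S) S :=
  (jumpKernel R).comap (fun h => h ⟨n, Finset.mem_Iic.2 le_rfl⟩) (measurable_pi_apply _)

instance (R : S → Measure S) [∀ x, IsFiniteMeasure (R x)] (n : ℕ) :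
    IsMarkovKernel (stepKernel R n) := by
  unfold stepKernel; infer_instance

/-- Law of the jump chain `(Y n)` started from `x`. -/
def jumpChainLaw (R : S → Measure S) [∀ x, IsFiniteMeasure (R x)] (x : S) : Measure (ℕ → S) :=
  Kernel.traj (X := fun _ => S) (stepKernel R) 0 (fun _ => x)

/-- The sample space: a jump chain together with a sequence of clocks. -/
abbrev Path (S : Type) : Type := (ℕ → S) × (ℕ → ℝ)

/-- Law of the continuous-time chain started from `x`: the jump chain, and independently of it a
sequence of independent exponential clocks with parameter `1`. -/
def chainLaw (R : S → Measure S) [∀ x, IsFiniteMeasure (R x)] (x : S) : Measure (Path S) :=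
  (jumpChainLaw R x).prod (Measure.infinitePi fun _ : ℕ => expMeasure 1)

instance (R : S → Measure S) [∀ x, IsFiniteMeasure (R x)] (x : S) :
    IsProbabilityMeasure (chainLaw R x) := by
  haveI : IsProbabilityMeasure (expMeasure 1) := isProbabilityMeasure_expMeasure one_pos
  unfold chainLaw jumpChainLaw
  infer_instance

/-- The time spent in the `n`-th state `Y n`: the `n`-th clock divided by the total jump rate out
of `Y n`, an exponential time with that rate. -/
def holdingTime (R : S → Measure S) (ω : Path S) (n : ℕ) : ℝ≥0∞ :=
  ENNReal.ofReal (ω.2 n) / R (ω.1 n) Set.univ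

/-- The time at which the chain enters its `n`-th state. -/
def jumpTime (R : S → Measure S) (ω : Path S) (n : ℕ) : ℝ≥0∞ :=
  ∑ k ∈ Finset.range n, holdingTime R ω k

/-- The state of the chain at time `t`: it is `Y n` when `jumpTime n ≤ t < jumpTime (n + 1)`, and
`none` if there is no such `n` (infinitely many jumps have occurred by time `t`). -/
def stateAt (R : S → Measure S) (t : ℝ≥0) (ω : Path S) : Option S :=
  open Classical in
  if h : ∃ n, jumpTime R ω n ≤ t ∧ t < jumpTime R ω (n + 1) then some (ω.1 (Nat.find h)) else none

end MarkovChain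

/-! ### ASEP on the nonnegative integers with an open boundary at `0`

A configuration is the finite set of its occupied sites. -/

/-- The configuration obtained from `η` when the particle at `x` moves to `z`. -/
def move (η : Finset ℕ) (x z : ℕ) : Finset ℕ := insert z (η.erase x)

/-- Jump rates of ASEP with open boundary out of the configuration `η`: every particle jumps one
step to the right at rate `p` and, if it is not at `0`, one step to the left at rate `q`, provided
the target site is empty; a particle is injected at `0` at rate `α` if `0` is empty, and a particle
at `0` is ejected at rate `β`. -/
def rates (p q α β : ℝ) (η : Finset ℕ) : Measure (Finset ℕ) :=
  (∑ x ∈ η, if x + 1 ∈ η then 0 else ENNReal.ofReal p • Measure.dirac (move η x (x + 1)))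
  + (∑ x ∈ η, if x = 0 ∨ x - 1 ∈ η then 0
      else ENNReal.ofReal q • Measure.dirac (move η x (x - 1)))
  + (if 0 ∈ η then ENNReal.ofReal β • Measure.dirac (η.erase 0)
      else ENNReal.ofReal α • Measure.dirac (insert 0 η))

instance (p q α β : ℝ) (η : Finset ℕ) : IsFiniteMeasure (rates p q α β η) := by
  have key : ∀ (a : ℝ) (ξ : Finset ℕ), (ENNReal.ofReal a • Measure.dirac ξ) Set.univ < ⊤ := by
    intro a ξ; simp
  constructor
  simp only [rates, Measure.add_apply, Measure.finsetSum_apply]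
  refine ENNReal.add_lt_top.2 ⟨ENNReal.add_lt_top.2 ⟨?_, ?_⟩, ?_⟩
  · refine ENNReal.sum_lt_top.2 fun x _ => ?_
    split_ifs
    · simp
    · exact key _ _
  · refine ENNReal.sum_lt_top.2 fun x _ => ?_
    split_ifs
    · simp
    · exact key _ _
  · split_ifs <;> exact key _ _

/-- The law of ASEP with open boundary started from the configuration `η`. -/
def law (p q α β : ℝ) (η : Finset ℕ) : Measure (Path (Finset ℕ)) :=
  chainLaw (rates p q α β) η

/-- The configuration at time `t`. -/
def config (p q α β : ℝ) (t : ℝ≥0) (ω : Path (Finset ℕ)) : Option (Finset ℕ) :=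
  stateAt (rates p q α β) t ω

/-- The first time at which there are no particles left (`∞` if there is no such time).  For the
process without injection started from a single particle it is the time at which that particle is
ejected. -/
def ejectionTime (p q α β : ℝ) (ω : Path (Finset ℕ)) : ℝ≥0∞ :=
  ⨅ (t : ℝ≥0) (_ : config p q α β t ω = some ∅), (t : ℝ≥0∞)

end OpenASEP

end

/-!
The configuration is at all times empty or a single occupied site, so the jump chain is a walk of
one particle killed at ejection. Its transition operator `step` acts on functions of the position
that vanish after ejection, and `lintegral_jumpChainLaw_rates` expresses expectations along the
chain as iterates of `step`. Almost surely the chain stays at `∅` once there, where the holding time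
is infinite. Hence the process becomes empty if and only if its jump chain does, and the ejection
time is the total time spent in nonempty configurations. This gives two reductions:

* the probability of no ejection is the limit of `step^n 1` (`law_never_ejected`);
* if ejection is almost sure, its expected time is `∑ k, step^k g`, with `g` the mean holding time
  (`lintegral_ejectionTime`).

The limit `H` of `step^n 1` is harmonic with values in `[0, 1]`. The increments of a harmonic
function satisfy `p (d (x + 2) - d (x + 1)) = q (d (x + 1) - d x)` and `p (d 1 - d 0) = β d 0`.

* If `p ≤ q`, a nonzero harmonic function with `0 ≤ d 0` grows at least linearly when `0 < p`, and
  there is none when `p = 0`; so `H = 0` and ejection is almost sure.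
* If `q < p`, the function `S x = 1 - β / (p - q + β) * (q / p) ^ x` is harmonic and at most `1`, so
  `S ≤ H`. The difference `H - S` is harmonic, hence nondecreasing, and is bounded by `1 - S`, which
  tends to `0`; so `H = S` (`tendsto_survival`).
* If `p < q`, the function `u x = (x + q / β) / (q - p)` solves `u = g + step u`, so that
  `∑ k < n, step^k g = u - step^n u`. A quadratic `v` with `u + step v = v` makes `∑ n, step^n u`
  finite, so `step^n u` tends to `0` and `∑ k, step^k g = u` (`hasSum_meanHolding`).
* If `p = q` and `U = ∑ k, step^k g` were finite, it would have second difference `-2`, which is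
  impossible for a nonnegative function on a half-line (`not_summable_meanHolding`).
-/

namespace OpenASEP

open Filter Topology

/-! ### The jump chain -/

section MarkovChain

variable {S : Type} [MeasurableSpace S] [DiscreteMeasurableSpace S] [Countable S]
  (R : S → Measure S) [∀ x, IsFiniteMeasure (R x)]

instance (x : S) : IsProbabilityMeasure (jumpChainLaw R x) := by
  unfold jumpChainLaw; infer_instance

/-- The Markov property of the jump chain, for functions of two consecutive states. -/
lemma lintegral_jumpChainLaw_pair (x : S) (n : ℕ) (F : S → S → ℝ≥0∞) :
    ∫⁻ Y, F (Y n) (Y (n + 1)) ∂(jumpChainLaw R x) =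
      ∫⁻ Y, ∫⁻ z, F (Y n) z ∂(jumpLaw R (Y n)) ∂(jumpChainLaw R x) := by
  have hF : Measurable (Function.uncurry F) := Measurable.of_discrete
  let e : ((i : Finset.Iic n) → S) → S := fun h => h ⟨n, Finset.mem_Iic.2 le_rfl⟩
  have he : Measurable e := measurable_pi_apply _
  have h := Kernel.partialTraj_compProd_eq_map_traj (X := fun _ => S) (κ := stepKernel R)
    (Nat.zero_le n) (x₀ := fun _ => x)
  have hG : Measurable fun z : ((i : Finset.Iic n) → S) × S => F (e z.1) z.2 :=
    hF.comp ((he.comp measurable_fst).prodMk measurable_snd)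
  have h1 := congrArg (fun m => ∫⁻ z, F (e z.1) z.2 ∂m) h
  rw [Measure.lintegral_compProd hG, lintegral_map hG (by fun_prop),
    ← Kernel.traj_map_frestrictLe_apply, lintegral_map (hG.lintegral_kernel_prod_right')
      (by fun_prop)] at h1
  exact h1.symm

lemma lintegral_jumpChainLaw_succ (x : S) (n : ℕ) (F : S → ℝ≥0∞) :
    ∫⁻ Y, F (Y (n + 1)) ∂(jumpChainLaw R x) =
      ∫⁻ Y, ∫⁻ z, F z ∂(jumpLaw R (Y n)) ∂(jumpChainLaw R x) :=
  lintegral_jumpChainLaw_pair R x n fun _ z => F z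

lemma lintegral_jumpChainLaw_zero (x : S) (F : S → ℝ≥0∞) :
    ∫⁻ Y, F (Y 0) ∂(jumpChainLaw R x) = F x := by
  have hF : Measurable F := Measurable.of_discrete
  let e : ((i : Finset.Iic 0) → S) → S := fun h => h ⟨0, Finset.mem_Iic.2 le_rfl⟩
  have hG : Measurable fun z => F (e z) := hF.comp (measurable_pi_apply _)
  have h := Kernel.traj_map_frestrictLe_apply (X := fun _ => S) (κ := stepKernel R) 0 0
    (fun _ => x)
  have h1 := congrArg (fun m => ∫⁻ z, F (e z) ∂m) h
  rw [lintegral_map hG (by fun_prop), Kernel.partialTraj_self, Kernel.id_apply,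
    lintegral_dirac' _ hG] at h1
  exact h1

/-- An absorbing state is almost surely never left. -/
lemma ae_jumpChainLaw_absorbing (x a : S) (ha : R a Set.univ = 0) :
    ∀ᵐ Y ∂(jumpChainLaw R x), ∀ n, Y n = a → Y (n + 1) = a := by
  classical
  rw [ae_all_iff]
  intro n
  have h := lintegral_jumpChainLaw_pair R x n (fun s z => if s = a ∧ z ≠ a then 1 else 0)
  have h0 : ∀ s : S, ∫⁻ z, (if s = a ∧ z ≠ a then (1 : ℝ≥0∞) else 0) ∂(jumpLaw R s) = 0 := by
    intro s
    by_cases hs : s = a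
    · subst hs
      rw [jumpLaw, if_pos ha, lintegral_dirac' _ Measurable.of_discrete]
      simp
    · simp [hs]
  simp only [h0, lintegral_zero] at h
  rw [lintegral_eq_zero_iff] at h
  · filter_upwards [h] with Y hY hYa
    by_contra hne
    simp [hYa, hne] at hY
  · have hm : Measurable fun z : S × S => if z.1 = a ∧ z.2 ≠ a then (1 : ℝ≥0∞) else 0 :=
      Measurable.of_discrete
    have hp : Measurable fun Y : ℕ → S => (Y n, Y (n + 1)) := by fun_prop
    exact hm.comp hp

end MarkovChain

/-! ### Exponential clocks -/

lemma lintegral_ofReal_expMeasure_one : ∫⁻ x, ENNReal.ofReal x ∂(expMeasure 1) = 1 := by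
  -- `x e⁻ˣ` is the density of the gamma law with shape `2`.
  have key : ∀ x : ℝ, gammaPDF 1 1 x * ENNReal.ofReal x = gammaPDF 2 1 x := by
    intro x
    rcases lt_or_ge x 0 with hx | hx
    · rw [gammaPDF_of_neg hx, gammaPDF_of_neg hx, zero_mul]
    · rw [gammaPDF_of_nonneg hx, gammaPDF_of_nonneg hx, ← ENNReal.ofReal_mul (by positivity)]
      norm_num [Real.Gamma_two]
      ring_nf
  have hm : Measurable (gammaPDF 1 1) := (measurable_gammaPDFReal 1 1).ennreal_ofReal
  rw [expMeasure, gammaMeasure, lintegral_withDensity_eq_lintegral_mul _ hm (by fun_prop)]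
  simp only [Pi.mul_apply, key]
  exact lintegral_gammaPDF_eq_one two_pos one_pos

lemma ae_expMeasure_one_pos : ∀ᵐ x ∂(expMeasure 1), 0 < x := by
  have hm : Measurable (gammaPDF 1 1) := (measurable_gammaPDFReal 1 1).ennreal_ofReal
  rw [expMeasure, gammaMeasure, ae_withDensity_iff hm]
  have h0 : ∀ᵐ x : ℝ, x ≠ 0 := by simp [ae_iff]
  filter_upwards [h0] with x hx h
  rcases lt_or_gt_of_ne hx with hx | hx
  · exact absurd (gammaPDF_of_neg hx) h
  · exact hx

/-- Law of the clocks: independent exponential variables with parameter `1`. -/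
noncomputable abbrev clockLaw : Measure (ℕ → ℝ) := Measure.infinitePi fun _ : ℕ => expMeasure 1

instance : IsProbabilityMeasure (expMeasure 1) := isProbabilityMeasure_expMeasure one_pos

lemma lintegral_clock (k : ℕ) : ∫⁻ c, ENNReal.ofReal (c k) ∂clockLaw = 1 := by
  have h := measurePreserving_eval_infinitePi (fun _ : ℕ => expMeasure 1) k
  rw [← lintegral_ofReal_expMeasure_one, ← h.lintegral_comp (by fun_prop)]

lemma ae_clock_pos : ∀ᵐ c ∂clockLaw, ∀ k, 0 < c k := by
  rw [ae_all_iff]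
  intro k
  have h := measurePreserving_eval_infinitePi (fun _ : ℕ => expMeasure 1) k
  exact h.quasiMeasurePreserving.ae ae_expMeasure_one_pos

/-! ### Paths of the continuous-time chain -/

section Paths

variable {S : Type} [MeasurableSpace S] (R : S → Measure S)

lemma jumpTime_mono (ω : Path S) : Monotone (jumpTime R ω) := fun _ _ h =>
  Finset.sum_le_sum_of_subset (Finset.range_subset_range.2 h)

lemma exists_of_stateAt_eq_some {t : ℝ≥0} {ω : Path S} {a : S} (h : stateAt R t ω = some a) :
    ∃ n, ω.1 n = a ∧ jumpTime R ω n ≤ t := by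
  classical
  unfold stateAt at h
  split_ifs at h with h'
  exact ⟨_, Option.some_injective _ h, (Nat.find_spec h').1⟩

lemma stateAt_eq_some {t : ℝ≥0} {ω : Path S} {n : ℕ} (h1 : jumpTime R ω n ≤ t)
    (h2 : t < jumpTime R ω (n + 1)) : stateAt R t ω = some (ω.1 n) := by
  classical
  have hex : ∃ n, jumpTime R ω n ≤ t ∧ t < jumpTime R ω (n + 1) := ⟨n, h1, h2⟩
  have hn : Nat.find hex = n := by
    have hs := Nat.find_spec hex
    refine le_antisymm (Nat.find_min' hex ⟨h1, h2⟩) ?_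
    by_contra! hlt
    exact absurd (hs.2.trans_le ((jumpTime_mono R ω hlt).trans h1)) (lt_irrefl _)
  unfold stateAt
  rw [dif_pos hex, hn]

end Paths

/-! ### The chain of a single particle -/

/-- The transition operator of the jump chain of a single particle, acting on functions of the
position of the particle which vanish once the particle is ejected. -/
noncomputable def step (p q β : ℝ) (f : ℕ → ℝ) : ℕ → ℝ
  | 0 => p / (p + β) * f 1
  | x + 1 => p * f (x + 2) + q * f x

lemma move_singleton (x z : ℕ) : move {x} x z = {z} := by
  simp [move]

lemma rates_empty (p q β : ℝ) : rates p q 0 β ∅ = 0 := by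
  simp [rates]

lemma rates_zero (p q β : ℝ) : rates p q 0 β {0} =
    ENNReal.ofReal p • Measure.dirac {1} + ENNReal.ofReal β • Measure.dirac ∅ := by
  simp [rates, move_singleton]

lemma rates_succ (p q β : ℝ) (x : ℕ) : rates p q 0 β {x + 1} =
    ENNReal.ofReal p • Measure.dirac {x + 2} + ENNReal.ofReal q • Measure.dirac {x} := by
  simp [rates, move_singleton]

/-- The mean holding time of the particle at site `x`, the inverse of the total jump rate there:
`p + β` at the origin, where there is no jump to the left, and `p + q = 1` elsewhere. -/
noncomputable def meanHolding (p β : ℝ) : ℕ → ℝ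
  | 0 => 1 / (p + β)
  | _ + 1 => 1

lemma meanHolding_nonneg {p β : ℝ} (hp : 0 ≤ p) (hβ : 0 < β) (x : ℕ) :
    0 ≤ meanHolding p β x := by
  cases x <;> simp only [meanHolding] <;> positivity

lemma inv_rates_singleton {p q β : ℝ} (hp : 0 ≤ p) (hq : 0 ≤ q) (hpq : p + q = 1) (hβ : 0 < β)
    (x : ℕ) : (rates p q 0 β {x} Set.univ)⁻¹ = ENNReal.ofReal (meanHolding p β x) := by
  cases x with
  | zero =>
    rw [rates_zero, meanHolding, one_div, ENNReal.ofReal_inv_of_pos (by positivity),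
      ENNReal.ofReal_add hp hβ.le]
    simp
  | succ x =>
    rw [rates_succ, meanHolding]
    simp [← ENNReal.ofReal_add hp hq, hpq]

lemma rates_singleton_ne_zero {p q β : ℝ} (hp : 0 ≤ p) (hq : 0 ≤ q) (hpq : p + q = 1)
    (hβ : 0 < β) (x : ℕ) : rates p q 0 β {x} Set.univ ≠ 0 := by
  intro h
  have := inv_rates_singleton hp hq hpq hβ x
  rw [h, ENNReal.inv_zero] at this
  exact ENNReal.ofReal_ne_top this.symm

lemma lintegral_jumpLaw_singleton {p q β : ℝ} (hp : 0 ≤ p) (hq : 0 ≤ q) (hpq : p + q = 1)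
    (hβ : 0 < β) {F : Finset ℕ → ℝ≥0∞} {f : ℕ → ℝ} (hf : ∀ x, 0 ≤ f x) (h0 : F ∅ = 0)
    (hF : ∀ x, F {x} = ENNReal.ofReal (f x)) (x : ℕ) :
    ∫⁻ z, F z ∂(jumpLaw (rates p q 0 β) {x}) = ENNReal.ofReal (step p q β f x) := by
  rw [jumpLaw, if_neg (rates_singleton_ne_zero hp hq hpq hβ x), lintegral_smul_measure,
    inv_rates_singleton hp hq hpq hβ]
  have hp1 : 0 < p + β := by positivity
  cases x with
  | zero =>
    rw [rates_zero, lintegral_add_measure, lintegral_smul_measure, lintegral_smul_measure,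
      lintegral_dirac, lintegral_dirac, h0, hF, smul_zero, add_zero, smul_eq_mul, smul_eq_mul,
      ← ENNReal.ofReal_mul hp, meanHolding, ← ENNReal.ofReal_mul (by positivity), step]
    ring_nf
  | succ x =>
    have := hf x
    have := hf (x + 2)
    rw [rates_succ, lintegral_add_measure, lintegral_smul_measure, lintegral_smul_measure,
      lintegral_dirac, lintegral_dirac, hF, hF, smul_eq_mul, smul_eq_mul, smul_eq_mul,
      ← ENNReal.ofReal_mul hp, ← ENNReal.ofReal_mul hq, ← ENNReal.ofReal_add (by positivity)
      (by positivity), meanHolding, ENNReal.ofReal_one, one_mul, step]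

lemma lintegral_jumpLaw_empty (p q β : ℝ) (F : Finset ℕ → ℝ≥0∞) :
    ∫⁻ z, F z ∂(jumpLaw (rates p q 0 β) ∅) = F ∅ := by
  rw [jumpLaw, if_pos (by simp [rates_empty]), lintegral_dirac]

lemma step_nonneg {p q β : ℝ} (hp : 0 ≤ p) (hq : 0 ≤ q) (hβ : 0 < β) {f : ℕ → ℝ}
    (hf : ∀ x, 0 ≤ f x) (x : ℕ) : 0 ≤ step p q β f x := by
  have := hf 1
  cases x with
  | zero => simp only [step]; positivity
  | succ x =>
    have := hf x
    have := hf (x + 2)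
    simp only [step]; positivity

lemma iterate_step_nonneg {p q β : ℝ} (hp : 0 ≤ p) (hq : 0 ≤ q) (hβ : 0 < β) {f : ℕ → ℝ}
    (hf : ∀ x, 0 ≤ f x) (n : ℕ) : ∀ x, 0 ≤ (step p q β)^[n] f x := by
  induction n with
  | zero => exact hf
  | succ n ih =>
    rw [Function.iterate_succ_apply']
    exact step_nonneg hp hq hβ ih

/-- Expectations along the jump chain are iterates of the transition operator `step`. -/
lemma lintegral_jumpChainLaw_rates {p q β : ℝ} (hp : 0 ≤ p) (hq : 0 ≤ q) (hpq : p + q = 1)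
    (hβ : 0 < β) (y n : ℕ) {F : Finset ℕ → ℝ≥0∞} {f : ℕ → ℝ} (hf : ∀ x, 0 ≤ f x)
    (h0 : F ∅ = 0) (hF : ∀ x, F {x} = ENNReal.ofReal (f x)) :
    ∫⁻ Y, F (Y n) ∂(jumpChainLaw (rates p q 0 β) {y}) =
      ENNReal.ofReal ((step p q β)^[n] f y) := by
  induction n generalizing F f with
  | zero => rw [lintegral_jumpChainLaw_zero, hF, Function.iterate_zero_apply]
  | succ n ih =>
    rw [lintegral_jumpChainLaw_succ, Function.iterate_succ_apply]
    exact ih (F := fun η => ∫⁻ z, F z ∂(jumpLaw (rates p q 0 β) η))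
      (step_nonneg hp hq hβ hf) (by rw [lintegral_jumpLaw_empty, h0])
      (lintegral_jumpLaw_singleton hp hq hpq hβ hf h0 hF)

/-- Almost surely there is at most one particle: the chain stays in the set formed by `∅` and the
singletons. -/
lemma ae_jumpChainLaw_rates_mem {p q β : ℝ} (hp : 0 ≤ p) (hq : 0 ≤ q) (hpq : p + q = 1)
    (hβ : 0 < β) (y : ℕ) :
    ∀ᵐ Y ∂(jumpChainLaw (rates p q 0 β) {y}), ∀ n, Y n = ∅ ∨ ∃ x, Y n = {x} := by
  classical
  rw [ae_all_iff]
  intro n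
  have hm : Measurable fun η : Finset ℕ => if η = ∅ ∨ ∃ x, η = {x} then (0 : ℝ≥0∞) else 1 :=
    Measurable.of_discrete
  have h := lintegral_jumpChainLaw_rates hp hq hpq hβ y n (f := fun _ => 0)
    (F := fun η => if η = ∅ ∨ ∃ x, η = {x} then 0 else 1) (by simp) (by simp) (by simp)
  have hz : ∀ n : ℕ, (step p q β)^[n] (fun _ => 0) = fun _ => 0 := by
    intro n
    apply Function.iterate_fixed
    ext x
    cases x <;> simp [step]
  have hm' : Measurable fun Y : ℕ → Finset ℕ =>
      if Y n = ∅ ∨ ∃ x, Y n = {x} then (0 : ℝ≥0∞) else 1 := hm.comp (measurable_pi_apply n)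
  rw [hz, ENNReal.ofReal_zero, lintegral_eq_zero_iff hm'] at h
  filter_upwards [h] with Y hY
  by_contra hne
  simp [hne] at hY

/-- The almost sure properties of the path that the pathwise arguments need. -/
structure IsGood (ω : Path (Finset ℕ)) : Prop where
  absorbing : ∀ n, ω.1 n = ∅ → ω.1 (n + 1) = ∅
  mem : ∀ n, ω.1 n = ∅ ∨ ∃ x, ω.1 n = {x}
  clock_pos : ∀ n, 0 < ω.2 n

lemma ae_isGood {p q β : ℝ} (hp : 0 ≤ p) (hq : 0 ≤ q) (hpq : p + q = 1)
    (hβ : 0 < β) (y : ℕ) : ∀ᵐ ω ∂(law p q 0 β {y}), IsGood ω := by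
  have h1 : ∀ᵐ ω ∂(law p q 0 β {y}), ∀ n, ω.1 n = ∅ → ω.1 (n + 1) = ∅ :=
    Measure.quasiMeasurePreserving_fst.ae
      (ae_jumpChainLaw_absorbing (rates p q 0 β) {y} ∅ (by simp [rates_empty]))
  have h2 : ∀ᵐ ω ∂(law p q 0 β {y}), ∀ n, ω.1 n = ∅ ∨ ∃ x, ω.1 n = {x} :=
    Measure.quasiMeasurePreserving_fst.ae (ae_jumpChainLaw_rates_mem hp hq hpq hβ y)
  have h3 : ∀ᵐ ω ∂(law p q 0 β {y}), ∀ n, 0 < ω.2 n :=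
    Measure.quasiMeasurePreserving_snd.ae ae_clock_pos
  filter_upwards [h1, h2, h3] with ω a b c
  exact ⟨a, b, c⟩

/-! ### Ejection in terms of the jump chain -/

lemma IsGood.eq_empty_of_le {ω : Path (Finset ℕ)} (h : IsGood ω) {n m : ℕ} (hnm : n ≤ m)
    (hn : ω.1 n = ∅) : ω.1 m = ∅ := by
  induction m, hnm using Nat.le_induction with
  | base => exact hn
  | succ m _ ih => exact h.absorbing m ih

lemma IsGood.holdingTime_lt_top {p q β : ℝ} (hp : 0 ≤ p) (hq : 0 ≤ q) (hpq : p + q = 1)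
    (hβ : 0 < β) {ω : Path (Finset ℕ)} (h : IsGood ω) {n : ℕ} (hn : ω.1 n ≠ ∅) :
    holdingTime (rates p q 0 β) ω n < ⊤ := by
  obtain ⟨x, hx⟩ := (h.mem n).resolve_left hn
  rw [holdingTime, hx]
  exact ENNReal.div_lt_top ENNReal.ofReal_ne_top (rates_singleton_ne_zero hp hq hpq hβ x)

lemma IsGood.holdingTime_eq_top (p q β : ℝ) {ω : Path (Finset ℕ)} (h : IsGood ω) {n : ℕ}
    (hn : ω.1 n = ∅) : holdingTime (rates p q 0 β) ω n = ⊤ := by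
  rw [holdingTime, hn, rates_empty, Measure.coe_zero, Pi.zero_apply]
  exact ENNReal.div_zero (ENNReal.ofReal_pos.2 (h.clock_pos n)).ne'

/-- If the jump chain reaches `∅` first at its `N`-th step, then that step happens at a finite time,
at which the configuration is empty. -/
lemma IsGood.exists_jumpTime_eq {p q β : ℝ} (hp : 0 ≤ p) (hq : 0 ≤ q) (hpq : p + q = 1)
    (hβ : 0 < β) {ω : Path (Finset ℕ)} (h : IsGood ω) {N : ℕ} (hN : ω.1 N = ∅)
    (hlt : ∀ k < N, ω.1 k ≠ ∅) :
    ∃ t : ℝ≥0, (t : ℝ≥0∞) = jumpTime (rates p q 0 β) ω N ∧ config p q 0 β t ω = some ∅ := by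
  have hfin : jumpTime (rates p q 0 β) ω N ≠ ⊤ := by
    refine (ENNReal.sum_lt_top.2 fun k hk => ?_).ne
    exact h.holdingTime_lt_top hp hq hpq hβ (hlt k (Finset.mem_range.1 hk))
  refine ⟨(jumpTime (rates p q 0 β) ω N).toNNReal, ENNReal.coe_toNNReal hfin, ?_⟩
  rw [config, stateAt_eq_some (n := N), hN]
  · rw [ENNReal.coe_toNNReal hfin]
  · rw [jumpTime.eq_1 _ _ (N + 1), Finset.sum_range_succ, h.holdingTime_eq_top p q β hN, add_top]
    exact ENNReal.coe_lt_top

lemma IsGood.exists_config_eq_empty_iff {p q β : ℝ} (hp : 0 ≤ p) (hq : 0 ≤ q) (hpq : p + q = 1)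
    (hβ : 0 < β) {ω : Path (Finset ℕ)} (h : IsGood ω) :
    (∃ t : ℝ≥0, config p q 0 β t ω = some ∅) ↔ ∃ n, ω.1 n = ∅ := by
  classical
  constructor
  · rintro ⟨t, ht⟩
    obtain ⟨n, hn, -⟩ := exists_of_stateAt_eq_some _ ht
    exact ⟨n, hn⟩
  · intro hex
    obtain ⟨t, -, ht⟩ := h.exists_jumpTime_eq hp hq hpq hβ (Nat.find_spec hex)
      fun k hk => Nat.find_min hex hk
    exact ⟨t, ht⟩

/-- The ejection time is the total time spent in nonempty configurations. -/
lemma IsGood.ejectionTime_eq_tsum {p q β : ℝ} (hp : 0 ≤ p) (hq : 0 ≤ q) (hpq : p + q = 1)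
    (hβ : 0 < β) {ω : Path (Finset ℕ)} (h : IsGood ω) (hex : ∃ n, ω.1 n = ∅) :
    ejectionTime p q 0 β ω =
      ∑' k, if ω.1 k = ∅ then 0 else holdingTime (rates p q 0 β) ω k := by
  classical
  have hN := Nat.find_spec hex
  have hlt : ∀ k < Nat.find hex, ω.1 k ≠ ∅ := fun k hk => Nat.find_min hex hk
  have hsum : ∑' k, (if ω.1 k = ∅ then 0 else holdingTime (rates p q 0 β) ω k) =
      jumpTime (rates p q 0 β) ω (Nat.find hex) := by
    rw [tsum_eq_sum (s := Finset.range (Nat.find hex)), jumpTime]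
    · exact Finset.sum_congr rfl fun k hk => if_neg (hlt k (Finset.mem_range.1 hk))
    · intro k hk
      rw [Finset.mem_range, not_lt] at hk
      exact if_pos (h.eq_empty_of_le hk hN)
  rw [hsum]
  refine le_antisymm ?_ ?_
  · obtain ⟨t, ht, htc⟩ := h.exists_jumpTime_eq hp hq hpq hβ hN hlt
    rw [← ht]
    exact iInf₂_le t htc
  · refine le_iInf₂ fun t ht => ?_
    obtain ⟨n, hn, hnt⟩ := exists_of_stateAt_eq_some _ ht
    exact (jumpTime_mono _ ω (Nat.find_min' hex hn)).trans hnt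

/-- The probability that the particle is still present after `n` jumps. -/
lemma law_ne_empty {p q β : ℝ} (hp : 0 ≤ p) (hq : 0 ≤ q) (hpq : p + q = 1) (hβ : 0 < β)
    (y n : ℕ) : law p q 0 β {y} {ω | ω.1 n ≠ ∅} =
      ENNReal.ofReal ((step p q β)^[n] (fun _ => 1) y) := by
  classical
  have hs : MeasurableSet {Y : ℕ → Finset ℕ | Y n ≠ ∅} :=
    (MeasurableSet.of_discrete (s := {η : Finset ℕ | η ≠ ∅})).preimage (measurable_pi_apply n)
  have h1 : law p q 0 β {y} {ω | ω.1 n ≠ ∅} =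
      jumpChainLaw (rates p q 0 β) {y} {Y | Y n ≠ ∅} :=
    (measurePreserving_fst (μ := jumpChainLaw (rates p q 0 β) {y})
      (ν := clockLaw)).measure_preimage hs.nullMeasurableSet
  rw [h1, ← lintegral_jumpChainLaw_rates hp hq hpq hβ y n (f := fun _ => 1)
    (F := fun η => if η = ∅ then 0 else 1) (by simp) (by simp) (by simp),
    ← lintegral_indicator_one hs]
  congr with Y
  by_cases hY : Y n = ∅ <;> simp [hY]

lemma law_never_ejected {p q β : ℝ} (hp : 0 ≤ p) (hq : 0 ≤ q) (hpq : p + q = 1) (hβ : 0 < β)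
    (y : ℕ) {a : ℝ}
    (ha : Tendsto (fun n => (step p q β)^[n] (fun _ => 1) y) atTop (𝓝 a)) :
    law p q 0 β {y} {ω | ∀ t : ℝ≥0, config p q 0 β t ω ≠ some ∅} = ENNReal.ofReal a := by
  have hgood := ae_isGood hp hq hpq hβ y
  have h1 : law p q 0 β {y} {ω | ∀ t : ℝ≥0, config p q 0 β t ω ≠ some ∅} =
      law p q 0 β {y} (⋂ n, {ω | ∀ k ≤ n, ω.1 k ≠ ∅}) := by
    refine measure_congr ?_
    filter_upwards [hgood] with ω hω
    refine propext ?_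
    have := hω.exists_config_eq_empty_iff hp hq hpq hβ
    rw [← not_iff_not] at this
    simp only [not_exists] at this
    change (∀ t : ℝ≥0, config p q 0 β t ω ≠ some ∅) ↔ ω ∈ ⋂ n, {ω | ∀ k ≤ n, ω.1 k ≠ ∅}
    rw [this, Set.mem_iInter]
    exact ⟨fun h n k _ => h k, fun h n => h n n le_rfl⟩
  have h2 : ∀ n, law p q 0 β {y} {ω | ∀ k ≤ n, ω.1 k ≠ ∅} =
      ENNReal.ofReal ((step p q β)^[n] (fun _ => 1) y) := by
    intro n
    rw [← law_ne_empty hp hq hpq hβ]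
    refine measure_congr ?_
    filter_upwards [hgood] with ω hω
    exact propext ⟨fun h => h n le_rfl, fun h k hk hk' => h (hω.eq_empty_of_le hk hk')⟩
  have hs : ∀ n, MeasurableSet {ω : Path (Finset ℕ) | ∀ k ≤ n, ω.1 k ≠ ∅} := by
    intro n
    have : {ω : Path (Finset ℕ) | ∀ k ≤ n, ω.1 k ≠ ∅} =
        ⋂ k, ⋂ _ : k ≤ n, (fun ω => ω.1 k) ⁻¹' {η | η ≠ ∅} := by ext; simp
    rw [this]
    refine MeasurableSet.iInter fun k => MeasurableSet.iInter fun _ => ?_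
    exact ((measurable_pi_apply k).comp measurable_fst) MeasurableSet.of_discrete
  have hanti : Antitone fun n => {ω : Path (Finset ℕ) | ∀ k ≤ n, ω.1 k ≠ ∅} :=
    fun n m hnm ω h k hk => h k (hk.trans hnm)
  have : IsProbabilityMeasure (law p q 0 β {y}) := by unfold law; infer_instance
  have h3 := tendsto_measure_iInter_atTop (μ := law p q 0 β {y})
    (fun n => (hs n).nullMeasurableSet) hanti ⟨0, measure_ne_top _ _⟩
  simp only [Function.comp_def, h2] at h3
  rw [h1]
  exact tendsto_nhds_unique h3 ((ENNReal.continuous_ofReal.tendsto a).comp ha)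

lemma ae_ejected {p q β : ℝ} (hp : 0 ≤ p) (hq : 0 ≤ q) (hpq : p + q = 1) (hβ : 0 < β)
    (y : ℕ) (ha : Tendsto (fun n => (step p q β)^[n] (fun _ => 1) y) atTop (𝓝 0)) :
    ∀ᵐ ω ∂(law p q 0 β {y}), ∃ t : ℝ≥0, config p q 0 β t ω = some ∅ := by
  have h := law_never_ejected hp hq hpq hβ y ha
  rw [ENNReal.ofReal_zero] at h
  rw [ae_iff]
  simpa only [not_exists] using h

/-- The expected ejection time is the sum over the jumps of the expected holding times. -/
lemma lintegral_ejectionTime {p q β : ℝ} (hp : 0 ≤ p) (hq : 0 ≤ q) (hpq : p + q = 1)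
    (hβ : 0 < β) (y : ℕ)
    (h : ∀ᵐ ω ∂(law p q 0 β {y}), ∃ t : ℝ≥0, config p q 0 β t ω = some ∅) :
    ∫⁻ ω, ejectionTime p q 0 β ω ∂(law p q 0 β {y}) =
      ∑' k, ENNReal.ofReal ((step p q β)^[k] (meanHolding p β) y) := by
  classical
  let F : Finset ℕ → ℝ≥0∞ := fun η => if η = ∅ then 0 else (rates p q 0 β η Set.univ)⁻¹
  have hFm : ∀ k : ℕ, Measurable fun Y : ℕ → Finset ℕ => F (Y k) := fun k =>
    (Measurable.of_discrete (f := F)).comp (measurable_pi_apply k)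
  have hcm : ∀ k : ℕ, Measurable fun c : ℕ → ℝ => ENNReal.ofReal (c k) := fun k => by fun_prop
  have hpath : ∀ᵐ ω ∂(law p q 0 β {y}),
      ejectionTime p q 0 β ω = ∑' k, F (ω.1 k) * ENNReal.ofReal (ω.2 k) := by
    filter_upwards [h, ae_isGood hp hq hpq hβ y] with ω hω hgood
    rw [hgood.ejectionTime_eq_tsum hp hq hpq hβ
      ((hgood.exists_config_eq_empty_iff hp hq hpq hβ).1 hω)]
    refine tsum_congr fun k => ?_
    by_cases hk : ω.1 k = ∅
    · simp [F, hk]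
    · simp only [F, hk, if_false, holdingTime, div_eq_mul_inv, mul_comm]
  have hmeas : ∀ k : ℕ, Measurable fun ω : Path (Finset ℕ) =>
      F (ω.1 k) * ENNReal.ofReal (ω.2 k) := fun k =>
    ((hFm k).comp measurable_fst).mul ((hcm k).comp measurable_snd)
  rw [lintegral_congr_ae hpath, lintegral_tsum fun k => (hmeas k).aemeasurable]
  refine tsum_congr fun k => ?_
  have hprod := lintegral_prod_mul (μ := jumpChainLaw (rates p q 0 β) {y}) (ν := clockLaw)
    (hFm k).aemeasurable (hcm k).aemeasurable
  rw [lintegral_clock, mul_one] at hprod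
  refine hprod.trans ?_
  refine lintegral_jumpChainLaw_rates hp hq hpq hβ y k (meanHolding_nonneg hp hβ) (by simp [F]) fun x => ?_
  simp only [F, Finset.singleton_ne_empty, if_false]
  exact inv_rates_singleton hp hq hpq hβ x

/-! ### The transition operator -/

section Step

variable {p q β : ℝ}

lemma step_mono (hp : 0 ≤ p) (hq : 0 ≤ q) (hβ : 0 < β) : Monotone (step p q β) := by
  intro f g h x
  cases x with
  | zero => exact mul_le_mul_of_nonneg_left (h 1) (by positivity)
  | succ x =>
    exact add_le_add (mul_le_mul_of_nonneg_left (h _) hp) (mul_le_mul_of_nonneg_left (h _) hq)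

lemma step_add (f g : ℕ → ℝ) : step p q β (f + g) = step p q β f + step p q β g := by
  ext x
  cases x <;> simp only [step, Pi.add_apply] <;> ring

lemma step_sub (f g : ℕ → ℝ) : step p q β (f - g) = step p q β f - step p q β g := by
  ext x
  cases x <;> simp only [step, Pi.sub_apply] <;> ring

lemma iterate_step_add (f g : ℕ → ℝ) (n : ℕ) :
    (step p q β)^[n] (f + g) = (step p q β)^[n] f + (step p q β)^[n] g := by
  induction n generalizing f g with
  | zero => rfl
  | succ n ih => simp only [Function.iterate_succ_apply, step_add, ih]

lemma tendsto_step {f : ℕ → ℕ → ℝ} {g : ℕ → ℝ} (h : ∀ x, Tendsto (fun n => f n x) atTop (𝓝 (g x)))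
    (x : ℕ) : Tendsto (fun n => step p q β (f n) x) atTop (𝓝 (step p q β g x)) := by
  cases x with
  | zero => exact (h 1).const_mul _
  | succ x => exact ((h _).const_mul _).add ((h _).const_mul _)

lemma sum_iterate_step {u g : ℕ → ℝ} (h : u = g + step p q β u) (n : ℕ) :
    ∑ k ∈ Finset.range n, (step p q β)^[k] g = u - (step p q β)^[n] u := by
  induction n with
  | zero => simp
  | succ n ih =>
    have : (step p q β)^[n] u = (step p q β)^[n] g + (step p q β)^[n + 1] u := by
      rw [Function.iterate_succ_apply, ← iterate_step_add, ← h]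
    rw [Finset.sum_range_succ, ih, this]
    abel

/-- A nonnegative function dominated by the drift of a Lyapunov function is summable along the
chain. -/
lemma tendsto_iterate_step_zero (hp : 0 ≤ p) (hq : 0 ≤ q) (hβ : 0 < β) {u v : ℕ → ℝ}
    (hu : ∀ x, 0 ≤ u x) (hv : ∀ x, 0 ≤ v x) (h : u + step p q β v ≤ v) (x : ℕ) :
    Tendsto (fun n => (step p q β)^[n] u x) atTop (𝓝 0) := by
  have hle : ∀ n, ∑ k ∈ Finset.range n, (step p q β)^[k] u x ≤ v x - (step p q β)^[n] v x := by
    intro n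
    induction n with
    | zero => simp
    | succ n ih =>
      have h1 := (step_mono hp hq hβ).iterate n h x
      rw [iterate_step_add, ← Function.iterate_succ_apply, Pi.add_apply] at h1
      rw [Finset.sum_range_succ]
      linarith
  refine (summable_of_sum_range_le (c := v x)
    (fun n => iterate_step_nonneg hp hq hβ hu n x) fun n => ?_).tendsto_atTop_zero
  linarith [hle n, iterate_step_nonneg hp hq hβ hv n x]

lemma harmonic_zero_increment (hp : 0 ≤ p) (hβ : 0 < β) {d : ℕ → ℝ} (h : step p q β d = d) :
    p * (d 1 - d 0) = β * d 0 := by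
  have h0 := congrFun h 0
  have : p + β ≠ 0 := by positivity
  simp only [step] at h0
  field_simp at h0
  linarith

lemma harmonic_succ_increment (hpq : p + q = 1) {d : ℕ → ℝ} (h : step p q β d = d) (x : ℕ) :
    p * (d (x + 2) - d (x + 1)) = q * (d (x + 1) - d x) := by
  have h0 := congrFun h (x + 1)
  simp only [step] at h0
  linear_combination h0 - d (x + 1) * hpq

lemma harmonic_monotone (hp : 0 < p) (hq : 0 ≤ q) (hpq : p + q = 1) (hβ : 0 < β) {d : ℕ → ℝ}
    (h : step p q β d = d) (h0 : 0 ≤ d 0) : Monotone d := by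
  refine monotone_nat_of_le_succ fun x => ?_
  induction x with
  | zero =>
    have h1 := harmonic_zero_increment hp.le hβ h
    have : 0 ≤ p * (d 1 - d 0) := h1 ▸ by positivity
    linarith [(mul_nonneg_iff_of_pos_left hp).1 this]
  | succ x ih =>
    have h1 := harmonic_succ_increment hpq h x
    have : 0 ≤ p * (d (x + 2) - d (x + 1)) := h1 ▸ mul_nonneg hq (sub_nonneg.2 ih)
    linarith [(mul_nonneg_iff_of_pos_left hp).1 this]

/-- Without drift to the right a bounded harmonic function vanishes: its increments are
nondecreasing. -/
lemma harmonic_eq_zero_of_bounded (hp : 0 ≤ p) (hpq : p + q = 1) (hβ : 0 < β) (hle : p ≤ q)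
    {d : ℕ → ℝ} (h : step p q β d = d) (h0 : 0 ≤ d 0) {C : ℝ} (hC : ∀ x, d x ≤ C) (x : ℕ) :
    d x = 0 := by
  rcases hp.eq_or_lt with rfl | hp
  · induction x with
    | zero => simpa [step] using (congrFun h 0).symm
    | succ x ih =>
      have := congrFun h (x + 1)
      simpa [step, ih] using this.symm
  have hmono := harmonic_monotone hp (hp.le.trans hle) hpq hβ h h0
  have hinc : ∀ x, β * d 0 ≤ p * (d (x + 1) - d x) := by
    intro x
    induction x with
    | zero => exact (harmonic_zero_increment hp.le hβ h).ge
    | succ x ih =>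
      rw [harmonic_succ_increment hpq h x]
      exact ih.trans (mul_le_mul_of_nonneg_right hle (sub_nonneg.2 (hmono x.le_succ)))
  have hlin : ∀ x : ℕ, x * (β * d 0) ≤ p * d x := by
    intro x
    induction x with
    | zero => simp only [Nat.cast_zero, zero_mul]; positivity
    | succ x ih =>
      push_cast
      linarith [hinc x]
  have hd0 : d 0 = 0 := by
    refine le_antisymm ?_ h0
    by_contra! hpos
    obtain ⟨n, hn⟩ := exists_nat_gt (p * C / (β * d 0))
    rw [div_lt_iff₀ (by positivity)] at hn
    exact absurd (hn.trans_le (hlin n)) (not_lt.2 (mul_le_mul_of_nonneg_left (hC n) hp.le))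
  have hconst : ∀ x, d x = 0 ∧ d (x + 1) = 0 := by
    intro x
    induction x with
    | zero =>
      have h1 := harmonic_zero_increment hp.le hβ h
      simp only [hd0, mul_zero, sub_zero, mul_eq_zero, hp.ne', false_or] at h1
      exact ⟨hd0, h1⟩
    | succ x ih =>
      have h1 := harmonic_succ_increment hpq h x
      simp only [ih.1, ih.2, sub_zero, mul_zero, mul_eq_zero, hp.ne', false_or] at h1
      exact ⟨ih.2, h1⟩
  exact (hconst x).1

/-- The survival probabilities decrease to a harmonic function. -/
lemma exists_survival_limit (hp : 0 ≤ p) (hq : 0 ≤ q) (hpq : p + q = 1) (hβ : 0 < β) :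
    ∃ H : ℕ → ℝ, (∀ x, Tendsto (fun n => (step p q β)^[n] (fun _ => 1) x) atTop (𝓝 (H x))) ∧
      step p q β H = H ∧ (∀ x, 0 ≤ H x) ∧ ∀ x, H x ≤ 1 := by
  have hone : step p q β (fun _ => 1) ≤ fun _ => 1 := by
    intro x
    cases x with
    | zero =>
      simp only [step, mul_one]
      exact div_le_one_of_le₀ (by linarith) (by positivity)
    | succ x => simp only [step, mul_one, hpq, le_refl]
  have hanti : ∀ x, Antitone fun n => (step p q β)^[n] (fun _ => (1 : ℝ)) x := fun x =>
    antitone_nat_of_succ_le fun n => by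
      rw [Function.iterate_succ_apply]
      exact (step_mono hp hq hβ).iterate n hone x
  have h0 := iterate_step_nonneg hp hq hβ (f := fun _ => 1) (by simp)
  have hlim : ∀ x, ∃ l, Tendsto (fun n => (step p q β)^[n] (fun _ => 1) x) atTop (𝓝 l) := fun x =>
    ⟨_, tendsto_atTop_ciInf (hanti x) ⟨0, by rintro _ ⟨n, rfl⟩; exact h0 n x⟩⟩
  choose H hH using hlim
  refine ⟨H, hH, ?_, fun x => ge_of_tendsto' (hH x) fun n => h0 n x,
    fun x => le_of_tendsto' (hH x) fun n => hanti x n.zero_le⟩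
  ext x
  refine tendsto_nhds_unique (tendsto_step hH x) ?_
  refine ((tendsto_add_atTop_iff_nat 1).2 (hH x)).congr fun n => ?_
  rw [Function.iterate_succ_apply']

lemma tendsto_survival_zero (hp : 0 ≤ p) (hpq : p + q = 1) (hβ : 0 < β) (hle : p ≤ q) (y : ℕ) :
    Tendsto (fun n => (step p q β)^[n] (fun _ => 1) y) atTop (𝓝 0) := by
  obtain ⟨H, hH, hharm, h0, h1⟩ := exists_survival_limit hp (hp.trans hle) hpq hβ
  rw [← harmonic_eq_zero_of_bounded hp hpq hβ hle hharm (h0 0) h1 y]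
  exact hH y

lemma tendsto_survival (hq : 0 ≤ q) (hpq : p + q = 1) (hβ : 0 < β) (hlt : q < p) (y : ℕ) :
    Tendsto (fun n => (step p q β)^[n] (fun _ => 1) y) atTop
      (𝓝 (1 - β / (p - q + β) * (q / p) ^ y)) := by
  have hp : 0 < p := hq.trans_lt hlt
  obtain ⟨H, hH, hharm, h0, h1⟩ := exists_survival_limit hp.le hq hpq hβ
  let S : ℕ → ℝ := fun x => 1 - β / (p - q + β) * (q / p) ^ x
  have hden : 0 < p - q + β := by linarith
  have hr0 : 0 ≤ q / p := by positivity
  have hr1 : q / p < 1 := (div_lt_one hp).2 hlt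
  have hS : step p q β S = S := by
    ext x
    cases x with
    | zero =>
      simp only [step, S, pow_one, pow_zero]
      field_simp
      ring
    | succ x =>
      simp only [step, S, pow_succ]
      obtain rfl : q = 1 - p := by linarith
      field_simp
      ring
  have hSle : S ≤ fun _ => 1 := fun x => by
    have : 0 ≤ β / (p - q + β) * (q / p) ^ x := by positivity
    simp only [S]
    linarith
  have hSH : ∀ x, S x ≤ H x := fun x => ge_of_tendsto' (hH x) fun n => by
    have := (step_mono hp.le hq hβ).iterate n hSle x
    rwa [Function.iterate_fixed hS] at this
  -- `H - S` is harmonic and nonnegative, hence nondecreasing, and it is at most `1 - S`, which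
  -- tends to `0` at infinity.
  have hmono := harmonic_monotone hp hq hpq hβ (d := H - S) (by rw [step_sub, hharm, hS])
    (sub_nonneg.2 (hSH 0))
  have hlim : Tendsto (fun x : ℕ => β / (p - q + β) * (q / p) ^ x) atTop (𝓝 0) := by
    simpa using (tendsto_pow_atTop_nhds_zero_of_lt_one hr0 hr1).const_mul (β / (p - q + β))
  have hle : (H - S) y ≤ 0 := by
    refine ge_of_tendsto hlim ?_
    filter_upwards [eventually_ge_atTop y] with x hx
    refine (hmono hx).trans ?_
    simp only [Pi.sub_apply, S]
    linarith [h1 x]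
  have : H y = S y := le_antisymm (sub_nonpos.1 hle) (hSH y)
  change Tendsto _ _ (𝓝 (S y))
  rw [← this]
  exact hH y

lemma hasSum_meanHolding (hp : 0 ≤ p) (hpq : p + q = 1) (hβ : 0 < β) (hlt : p < q) (y : ℕ) :
    HasSum (fun k => (step p q β)^[k] (meanHolding p β) y) (((y : ℝ) + q / β) / (q - p)) := by
  have hq : 0 < q := hp.trans_lt hlt
  have hδ : 0 < q - p := sub_pos.2 hlt
  let u : ℕ → ℝ := fun x => ((x : ℝ) + q / β) / (q - p)
  have hu0 : ∀ x, 0 ≤ u x := fun x => by simp only [u]; positivity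
  have hu : u = meanHolding p β + step p q β u := by
    ext x
    cases x with
    | zero =>
      simp only [u, Pi.add_apply, meanHolding, step, Nat.cast_zero, Nat.cast_one]
      have : p + β ≠ 0 := by positivity
      obtain rfl : q = 1 - p := by linarith
      field_simp
      ring
    | succ x =>
      simp only [u, Pi.add_apply, meanHolding, step]
      push_cast
      obtain rfl : q = 1 - p := by linarith
      field_simp
      ring
  -- The quadratic `a x² + b x + c` solves `v = u + step v`.
  obtain ⟨a, ha⟩ : ∃ a, a = 1 / (2 * (q - p) ^ 2) := ⟨_, rfl⟩
  obtain ⟨b, hb⟩ : ∃ b, b = (a + q / β / (q - p)) / (q - p) := ⟨_, rfl⟩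
  obtain ⟨c, hc⟩ : ∃ c, c = (p * (a + b) + (p + β) * (q / β / (q - p))) / β := ⟨_, rfl⟩
  have ha0 : 0 ≤ a := by rw [ha]; positivity
  have hb0 : 0 ≤ b := by rw [hb]; positivity
  have hc0 : 0 ≤ c := by rw [hc]; positivity
  let v : ℕ → ℝ := fun x => a * x ^ 2 + b * x + c
  have hv : u + step p q β v = v := by
    ext x
    cases x with
    | zero =>
      simp only [u, v, Pi.add_apply, step, Nat.cast_zero, Nat.cast_one]
      have : p + β ≠ 0 := by positivity
      have hc' : c * β = p * (a + b) + (p + β) * (q / β / (q - p)) := by rw [hc]; field_simp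
      rw [zero_add]
      generalize q / β / (q - p) = w at hc' ⊢
      field_simp
      linear_combination -hc'
    | succ x =>
      simp only [u, v, Pi.add_apply, step]
      push_cast
      have ha' : 2 * (q - p) * a = 1 / (q - p) := by rw [ha]; field_simp
      have hb' : b * (q - p) = a + q / β / (q - p) := by rw [hb]; field_simp
      rw [add_div, ← mul_one_div ((x : ℝ) + 1)]
      generalize q / β / (q - p) = w at hb' ⊢
      generalize 1 / (q - p) = i at ha' ⊢
      linear_combination -(x + 1 : ℝ) * ha' - hb' +
        (a * ((x + 1) ^ 2 + 1) + b * (x + 1) + c) * hpq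
  have hlim := tendsto_iterate_step_zero hp hq.le hβ hu0 (v := v)
    (fun x => by simp only [v]; positivity) hv.le y
  rw [hasSum_iff_tendsto_nat_of_nonneg fun k => iterate_step_nonneg hp hq.le hβ (meanHolding_nonneg hp hβ) k y]
  have h1 : ∀ n, ∑ k ∈ Finset.range n, (step p q β)^[k] (meanHolding p β) y =
      u y - (step p q β)^[n] u y := fun n => by
    rw [← Finset.sum_apply, sum_iterate_step hu, Pi.sub_apply]
  simp only [h1]
  simpa using hlim.const_sub (u y)

/-- In the symmetric case the sum `U` of the expected holding times would, if finite, have second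
difference `-2` away from the origin, contradicting `0 ≤ U`. -/
lemma not_summable_meanHolding (hβ : 0 < β) (y : ℕ) :
    ¬ Summable fun k => (step (1 / 2) (1 / 2) β)^[k] (meanHolding (1 / 2) β) y := by
  intro hsum
  have hg0 : ∀ x, 0 ≤ meanHolding (1 / 2) β x := meanHolding_nonneg (by norm_num) hβ
  let a : ℕ → ℕ → ℝ := fun k x => (step (1 / 2) (1 / 2) β)^[k] (meanHolding (1 / 2) β) x
  have ha0 : ∀ k x, 0 ≤ a k x := fun k =>
    iterate_step_nonneg (by norm_num) (by norm_num) hβ hg0 k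
  have hzero : ∀ k, a (k + 1) 0 = 1 / 2 / (1 / 2 + β) * a k 1 := fun k => by
    simp only [a, Function.iterate_succ_apply']; rfl
  have hsucc : ∀ k x, a (k + 1) (x + 1) = 1 / 2 * a k (x + 2) + 1 / 2 * a k x := fun k x => by
    simp only [a, Function.iterate_succ_apply']; rfl
  have hup : ∀ x, Summable (fun k => a k x) → Summable fun k => a k (x + 1) := by
    intro x hx
    have hx1 := (summable_nat_add_iff 1).2 hx
    cases x with
    | zero =>
      simp only [hzero] at hx1
      exact (summable_mul_left_iff (by positivity)).1 hx1
    | succ x =>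
      refine Summable.of_nonneg_of_le (ha0 · _) (fun k => ?_) (hx1.mul_left 2)
      rw [hsucc]
      linarith [ha0 k x]
  have hall : ∀ j, Summable fun k => a k (y + j) := by
    intro j
    induction j with
    | zero => exact hsum
    | succ j ih => exact hup _ ih
  let V : ℕ → ℝ := fun j => ∑' k, a k (y + j)
  have hV0 : ∀ j, 0 ≤ V j := fun j => tsum_nonneg fun k => ha0 k _
  have hrec : ∀ j, V (j + 1) = 1 + (1 / 2 * V (j + 2) + 1 / 2 * V j) := by
    intro j
    simp only [V]
    rw [(hall (j + 1)).tsum_eq_zero_add, ← tsum_mul_left, ← tsum_mul_left,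
      ← ((hall (j + 2)).mul_left _).tsum_add ((hall j).mul_left _)]
    exact congrArg₂ _ rfl (tsum_congr fun k => hsucc k (y + j))
  have hform : ∀ j : ℕ, V j = V 0 + j * (V 1 - V 0) - j * (j - 1) ∧
      V (j + 1) = V 0 + (j + 1) * (V 1 - V 0) - (j + 1) * j := by
    intro j
    induction j with
    | zero => simp
    | succ j ih =>
      refine ⟨by push_cast; linarith [ih.2], ?_⟩
      have := hrec j
      push_cast
      linarith [ih.1, ih.2]
  obtain ⟨n, hn⟩ := exists_nat_gt (V 0 + V 1 + 1)
  have h1 := (hform n).1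
  nlinarith [hV0 n, hV0 0, hV0 1]

end Step

end OpenASEP

theorem mainTheorem9 (p q β : ℝ) (hp : 0 ≤ p) (hq : 0 ≤ q) (hpq : p + q = 1) (hβ : 0 < β)
    (y : ℕ) :
    (q < p → 0 < q →
      OpenASEP.law p q 0 β {y} {ω | ∀ t : ℝ≥0, OpenASEP.config p q 0 β t ω ≠ some ∅} =
        ENNReal.ofReal (1 - β * (q⁻¹ - 1) ^ (-(y : ℤ)) / (p - q + β))) ∧
    (q = 0 →
      OpenASEP.law p q 0 β {y} {ω | ∀ t : ℝ≥0, OpenASEP.config p q 0 β t ω ≠ some ∅} =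
        ENNReal.ofReal (1 - if y = 0 then β / (1 + β) else 0)) ∧
    (p ≤ q →
      ∀ᵐ ω ∂(OpenASEP.law p q 0 β {y}), ∃ t : ℝ≥0, OpenASEP.config p q 0 β t ω = some ∅) ∧
    (p = q →
      ∫⁻ ω, OpenASEP.ejectionTime p q 0 β ω ∂(OpenASEP.law p q 0 β {y}) = ⊤) ∧
    (p < q →
      ∫⁻ ω, OpenASEP.ejectionTime p q 0 β ω ∂(OpenASEP.law p q 0 β {y}) =
        ENNReal.ofReal (((y : ℝ) + q / β) / (q - p))) := by
  have hdrift : p ≤ q → ∀ᵐ ω ∂(OpenASEP.law p q 0 β {y}),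
      ∃ t : ℝ≥0, OpenASEP.config p q 0 β t ω = some ∅ := fun hle =>
    OpenASEP.ae_ejected hp hq hpq hβ y (OpenASEP.tendsto_survival_zero hp hpq hβ hle y)
  refine ⟨fun hlt hq0 => ?_, fun hq0 => ?_, hdrift, fun heq => ?_, fun hlt => ?_⟩
  · rw [OpenASEP.law_never_ejected hp hq hpq hβ y (OpenASEP.tendsto_survival hq hpq hβ hlt y)]
    have hratio : q⁻¹ - 1 = (q / p)⁻¹ := by
      have : p ≠ 0 := (hq0.trans hlt).ne'
      field_simp
      linarith
    rw [hratio, inv_zpow', neg_neg, zpow_natCast, div_mul_eq_mul_div]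
  · subst hq0
    obtain rfl : p = 1 := by linarith
    rw [OpenASEP.law_never_ejected hp hq hpq hβ y
      (OpenASEP.tendsto_survival hq hpq hβ one_pos y)]
    rcases y with _ | y <;> simp [add_comm]
  · rw [OpenASEP.lintegral_ejectionTime hp hq hpq hβ y (hdrift heq.le)]
    obtain rfl : p = 1 / 2 := by linarith
    obtain rfl : q = 1 / 2 := by linarith
    by_contra hne
    refine OpenASEP.not_summable_meanHolding hβ y ((ENNReal.summable_toReal hne).congr fun k => ?_)
    exact ENNReal.toReal_ofReal
      (OpenASEP.iterate_step_nonneg hp hq hβ (OpenASEP.meanHolding_nonneg hp hβ) k y)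
  · have hsum := OpenASEP.hasSum_meanHolding hp hpq hβ hlt y
    rw [OpenASEP.lintegral_ejectionTime hp hq hpq hβ y (hdrift hlt.le), ← hsum.tsum_eq,
      ENNReal.ofReal_tsum_of_nonneg (fun k => OpenASEP.iterate_step_nonneg hp hq hβ
        (OpenASEP.meanHolding_nonneg hp hβ) k y) hsum.summable]
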